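/- Fix a finite set $P$ of binary node features. A graph $G=(V,E,\mathrm{lab})$ is a finite undirected loopless graph with labels $\mathrm{lab}(v)\subseteq P$; a pointed graph $(G,v)$ is a graph with a chosen node. A node classifier is an isomorphism-invariant map from pointed graphs to $\{0,1\}$. For a set $C$ of node classifiers, $\rho(C)$ is the set of pairs of pointed graphs on which every classifier in $C$ takes equal values. **HE-GNNs.** A $(D,D')$-GNN is a sequence of $L\ge 1$ layers $(\mathrm{agg}_i,\mathrm{com}_i)$ with arbitrary functions $\mathrm{agg}_i$ from finite multisets over $\mathbb{R}^{D_i}$ to $\mathbb{R}^{D_i}$ and $\mathrm{com}_i:\mathbb{R}^{2D_i}\to\mathbb{R}^{D_{i+1}}$, where $D_1=D$, $D_{L+1}=D'$ and $D_{i+1}\ge 1$; it updates an embedding $\mathrm{emb}:V\to\mathbb{R}^{D}$ by $\mathrm{emb}^{i}(v)=\mathrm{com}_i\big(\mathrm{emb}^{i-1}(v)\oplus\mathrm{agg}_i\{\!\{\mathrm{emb}^{i-1}(u) : (v,u)\in E\}\!\}\big)$, starting with $\mathrm{emb}^0=\mathrm{emb}$, and outputs $\mathrm{emb}^L$. A $(D,D')$-HE-GNN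 of nesting depth $0$ is a $(D,D')$-GNN; one of depth $d>0$ is a pair $(\mathcal B,\mathcal C)$ of a $(D+1,D'')$-HE-GNN $\mathcal B$ of depth $d-1$ and a $(D+D'',D')$-GNN $\mathcal C$, and it returns the result of running $\mathcal C$ on $v\mapsto \mathrm{emb}(v)\oplus \mathrm{run}_{\mathcal B}\big(G,\,u\mapsto \mathrm{emb}(u)\oplus\delta_{uv}\big)(v)$. An HE-GNN with $D=|P|$ and $D'=1$, run on the multi-hot encoding of the labels, classifies $(G,v)$ as $1$ iff its output at $v$ is positive. HE-GNN-$d$ is the set of all classifiers obtained with nesting depth $d$. **$k$-WL** ($k\ge 1$). The atomic type $\mathrm{atp}(\bar v)$ of a tuple of nodes records which entries are equal, which are adjacent, and the labels of the entries. Write $\bar v[w/j]$ for $\bar v$ with its $j$-th entry replaced by $w$. Colour $\bar v\in V^k$ by $c^0(\bar v)=\mathrm{atp}(\bar v)$ and $$c^{n+1}(\bar v)=\Big(c^n(\bar v),\ \{\!\{\big(\mathrm{atp}(\bar v w),\,c^n(\bar v[w/1]),\dots,c^n(\bar v[w/k])\big) : w\in V\}\!\}\Big).$$ Its classifiers are those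 that map $(G,v)$ to $1$ iff $c^n(v,\dots,v)\in S$, for a number of rounds $n\ge 0$ and a set $S$ of colours. **$k$-GNNs** ($k\ge 2$). A $k$-GNN is a sequence of $L\ge1$ layers, each with arbitrary aggregation functions $\mathrm{agg}_1,\dots,\mathrm{agg}_k$ from finite multisets over $\mathbb{R}^{D}$ to $\mathbb{R}^{D}$ and an arbitrary combination function $\mathrm{com}:\mathbb{R}^{(k+1)D}\to\mathbb{R}^{E}$, $E\ge 1$ (with $D,E$ depending on the layer). A layer updates an embedding $f:V^k\to\mathbb{R}^D$ to $$f'(\bar v)=\mathrm{com}\Big(f(\bar v)\oplus\bigoplus_{j=1}^{k}\mathrm{agg}_j\{\!\{f(\bar v[w/j]) : w\in V\}\!\}\Big).$$ The input is the one-hot encoding of the atomic types of the $k$-tuples, the output has dimension $1$, and $(G,v)$ is classified as $1$ iff the output at $(v,\dots,v)$ is positive. **Theorem.** For every finite $P$ and every $d\ge 0$, $$\rho\big((d+1)\text{-WL}\big)=\rho\big((d+2)\text{-GNN}\big)\subseteq\rho\big(\text{HE-GNN-}d\big).$$ -/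

import Mathlib

noncomputable section

/-! ## Graphs, pointed graphs and node classifiers -/

/-- A finite undirected graph without loops whose nodes carry binary features from `P`. -/
structure LabeledGraph (P : Type*) where
  V : Type
  [fintypeV : Fintype V]
  graph : SimpleGraph V
  lab : V → Set P

attribute [instance] LabeledGraph.fintypeV

/-- A graph together with one of its nodes. -/
structure PointedGraph (P : Type*) extends LabeledGraph P where
  pt : V

/-- `f` is an isomorphism of labelled graphs. -/
def IsGraphIso {P : Type*} {G H : LabeledGraph P} (f : G.V ≃ H.V) : Prop :=
  (∀ u w, H.graph.Adj (f u) (f w) ↔ G.graph.Adj u w) ∧ ∀ u, H.lab (f u) = G.lab u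

/-- Two pointed graphs are isomorphic. -/
def PointedIso {P : Type*} (A B : PointedGraph P) : Prop :=
  ∃ f : A.V ≃ B.V, IsGraphIso (G := A.toLabeledGraph) (H := B.toLabeledGraph) f ∧ f A.pt = B.pt

/-- A node classifier: an isomorphism invariant `{0,1}`-valued function on pointed graphs. -/
structure NodeClassifier (P : Type*) where
  toFun : PointedGraph P → Bool
  invariant : ∀ A B, PointedIso A B → toFun A = toFun B

/-- The equivalence relation `ρ(C)`: the pairs of pointed graphs on which all classifiers in `C`
agree. -/
def rho {P : Type*} (C : Set (NodeClassifier P)) : Set (PointedGraph P × PointedGraph P) :=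
  {q | ∀ c ∈ C, c.toFun q.1 = c.toFun q.2}

/-! ## Graph neural networks -/

/-- One layer: an aggregation function `ℳ(ℝ^D) → ℝ^D` and a combination function
`ℝ^(2D) → ℝ^E`, with `E ≥ 1`. Both functions are arbitrary. -/
structure GNNLayer (D E : ℕ) where
  pos : 0 < E
  agg : Multiset (Fin D → ℝ) → (Fin D → ℝ)
  com : (Fin (D + D) → ℝ) → (Fin E → ℝ)

/-- A `(D, D')`-GNN: a nonempty composable list of layers. -/
inductive GNN : ℕ → ℕ → Type
  | single {D D' : ℕ} (l : GNNLayer D D') : GNN D D'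
  | cons {D E D' : ℕ} (l : GNNLayer D E) (rest : GNN E D') : GNN D D'

/-- The multiset of the values of `emb` at the neighbours of `v`. -/
def nbrMultiset {P X : Type*} (G : LabeledGraph P) (emb : G.V → X) (v : G.V) : Multiset X :=
  open Classical in (Finset.univ.filter fun u => G.graph.Adj v u).val.map emb

/-- The effect of one layer on an embedding. -/
def GNNLayer.run {P : Type*} {D E : ℕ} (l : GNNLayer D E) (G : LabeledGraph P)
    (emb : G.V → Fin D → ℝ) : G.V → Fin E → ℝ :=
  fun v => l.com (Fin.append (emb v) (l.agg (nbrMultiset G emb v)))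

/-- The function on embeddings that a GNN computes. -/
def GNN.run {P : Type*} (G : LabeledGraph P) :
    {D D' : ℕ} → GNN D D' → (G.V → Fin D → ℝ) → (G.V → Fin D' → ℝ)
  | _, _, .single l, emb => l.run G emb
  | _, _, .cons l rest, emb => GNN.run G rest (l.run G emb)

/-- The multi-hot encoding of the labels, for a fixed enumeration of `P`. -/
def multiHot {P : Type*} [Fintype P] (G : LabeledGraph P) : G.V → Fin (Fintype.card P) → ℝ :=
  fun v i => open Classical in if (Fintype.equivFin P).symm i ∈ G.lab v then 1 else 0

/-! ## Hierarchical ego GNNs -/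

/-- `HEGNN d D D'` is the type of `(D, D')`-HE-GNNs of nesting depth `d`. -/
inductive HEGNN : ℕ → ℕ → ℕ → Type
  | base {D D' : ℕ} (A : GNN D D') : HEGNN 0 D D'
  | nest {d D D'' D' : ℕ} (B : HEGNN d (D + 1) D'') (C : GNN (D + D'') D') : HEGNN (d + 1) D D'

/-- Extend every node embedding by one coordinate, which is `1` at `v` and `0` elsewhere. -/
def markNode {V : Type*} {D : ℕ} (emb : V → Fin D → ℝ) (v : V) : V → Fin (D + 1) → ℝ :=
  fun u => open Classical in Fin.snoc (α := fun _ => ℝ) (emb u) (if u = v then 1 else 0)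

/-- The function on embeddings that an HE-GNN computes. -/
def HEGNN.run {P : Type*} (G : LabeledGraph P) :
    {d D D' : ℕ} → HEGNN d D D' → (G.V → Fin D → ℝ) → (G.V → Fin D' → ℝ)
  | _, _, _, .base A, emb => A.run G emb
  | _, _, _, .nest B C, emb =>
      C.run G fun v => Fin.append (emb v) (HEGNN.run G B (markNode emb v) v)

/-! ## Higher-order Weisfeiler–Leman -/

/-- Atomic types of `k`-tuples of nodes: which entries are equal, which are adjacent, and the
labels of the entries. -/
abbrev AtomicType (P : Type*) (k : ℕ) : Type _ :=
  (Fin k → Fin k → Prop) × (Fin k → Fin k → Prop) × (Fin k → Set P)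

/-- The atomic type of a tuple, i.e. the isomorphism type of the ordered induced subgraph. -/
def atp {P : Type*} (G : LabeledGraph P) {k : ℕ} (v : Fin k → G.V) : AtomicType P k :=
  (fun i j => v i = v j, fun i j => G.graph.Adj (v i) (v j), fun i => G.lab (v i))

/-- The colours of `k`-WL after `n` rounds. The perfect hash function is the one that keeps its
argument, so that two colours agree exactly when the hashed data agree. -/
def WLColor (P : Type*) (k : ℕ) : ℕ → Type _
  | 0 => AtomicType P k
  | n + 1 => WLColor P k n × Multiset (AtomicType P (k + 1) × (Fin k → WLColor P k n))

/-- The colouring of `k`-tuples after `n` rounds of `k`-WL: a tuple `v` starts with its atomic type;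
in a round it gets its old colour together with the multiset, over all nodes `w`, of the atomic type
of `(v₁, …, v_k, w)` and the old colours of `v[w/1], …, v[w/k]`. -/
def wlColor {P : Type*} (G : LabeledGraph P) (k : ℕ) :
    (n : ℕ) → (Fin k → G.V) → WLColor P k n
  | 0, v => atp G v
  | n + 1, v =>
      (wlColor G k n v, (Finset.univ : Finset G.V).val.map fun w =>
        (atp G (Fin.snoc (α := fun _ => G.V) v w : Fin (k + 1) → G.V),
          fun i => wlColor G k n (Function.update v i w)))

/-! ## Higher-order GNNs -/

/-- One layer of a `k`-GNN: an aggregation function for every position of the tuple and a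
combination function `ℝ^D × (ℝ^D)^k → ℝ^E`, with `E ≥ 1`. -/
structure KGNNLayer (k D E : ℕ) where
  pos : 0 < E
  agg : Fin k → Multiset (Fin D → ℝ) → (Fin D → ℝ)
  com : (Fin D → ℝ) → (Fin k → Fin D → ℝ) → (Fin E → ℝ)

/-- A `k`-GNN with input dimension `D` and output dimension `D'`. -/
inductive KGNN (k : ℕ) : ℕ → ℕ → Type
  | single {D D' : ℕ} (l : KGNNLayer k D D') : KGNN k D D'
  | cons {D E D' : ℕ} (l : KGNNLayer k D E) (rest : KGNN k E D') : KGNN k D D'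

/-- One layer of message passing between `k`-tuples: the neighbours of `v` at position `j` are the
tuples `v[w/j]`. -/
def KGNNLayer.run {P : Type*} {k D E : ℕ} (l : KGNNLayer k D E) (G : LabeledGraph P)
    (emb : (Fin k → G.V) → Fin D → ℝ) : (Fin k → G.V) → Fin E → ℝ :=
  fun v => l.com (emb v) fun j =>
    l.agg j ((Finset.univ : Finset G.V).val.map fun w => emb (Function.update v j w))

/-- The function on embeddings of `k`-tuples that a `k`-GNN computes. -/
def KGNN.run {P : Type*} (G : LabeledGraph P) {k : ℕ} :
    {D D' : ℕ} → KGNN k D D' → ((Fin k → G.V) → Fin D → ℝ) → ((Fin k → G.V) → Fin D' → ℝ)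
  | _, _, .single l, emb => l.run G emb
  | _, _, .cons l rest, emb => KGNN.run G rest (l.run G emb)

/-- The one-hot encoding of the atomic types of the `k`-tuples, for a fixed enumeration of the
finitely many atomic types. -/
def oneHotAtp {P : Type*} [Fintype P] (G : LabeledGraph P) (k : ℕ) :
    (Fin k → G.V) → Fin (Nat.card (AtomicType P k)) → ℝ :=
  fun v => Pi.single (Finite.equivFin (AtomicType P k) (atp G v)) 1

/-! ## Isomorphism invariance -/

section Invariance

variable {P : Type*} {G H : LabeledGraph P} {f : G.V ≃ H.V}

theorem nbrMultiset_iso {X : Type*} (hf : IsGraphIso f) (e : G.V → X) (e' : H.V → X)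
    (he : ∀ u, e' (f u) = e u) (v : G.V) : nbrMultiset H e' (f v) = nbrMultiset G e v := by
  classical
  have h : (Finset.univ.filter fun u => H.graph.Adj (f v) u)
      = (Finset.univ.filter fun u => G.graph.Adj v u).map f.toEmbedding := by
    ext u
    obtain ⟨u, rfl⟩ := f.surjective u
    simp [hf.1]
  unfold nbrMultiset
  convert_to ((Finset.univ.filter fun u => H.graph.Adj (f v) u)).val.map e' = _
  rw [h, Finset.map_val, Multiset.map_map]
  convert_to _ = ((Finset.univ.filter fun u => G.graph.Adj v u)).val.map e
  exact Multiset.map_congr rfl fun u _ => he u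

theorem univMultiset_iso {X : Type*} (f : G.V ≃ H.V) (e : G.V → X) (e' : H.V → X)
    (he : ∀ u, e' (f u) = e u) :
    (Finset.univ : Finset H.V).val.map e' = (Finset.univ : Finset G.V).val.map e := by
  rw [← Finset.map_univ_equiv f, Finset.map_val, Multiset.map_map]
  congr 1
  funext u
  exact he u

theorem GNNLayer.run_iso {D E : ℕ} (l : GNNLayer D E) (hf : IsGraphIso f)
    (e : G.V → Fin D → ℝ) (e' : H.V → Fin D → ℝ) (he : ∀ u, e' (f u) = e u) (v : G.V) :
    l.run H e' (f v) = l.run G e v := by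
  simp only [GNNLayer.run, he, nbrMultiset_iso hf e e' he]

theorem GNN.run_iso {D D' : ℕ} (A : GNN D D') (hf : IsGraphIso f) :
    ∀ (e : G.V → Fin D → ℝ) (e' : H.V → Fin D → ℝ), (∀ u, e' (f u) = e u) →
      ∀ v, A.run H e' (f v) = A.run G e v := by
  induction A with
  | single l => exact fun e e' he v => l.run_iso hf e e' he v
  | cons l rest ih => exact fun e e' he v => ih _ _ (l.run_iso hf e e' he) v

theorem HEGNN.run_iso {d D D' : ℕ} (A : HEGNN d D D') (hf : IsGraphIso f) :
    ∀ (e : G.V → Fin D → ℝ) (e' : H.V → Fin D → ℝ), (∀ u, e' (f u) = e u) →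
      ∀ v, A.run H e' (f v) = A.run G e v := by
  induction A with
  | base A => exact fun e e' he v => A.run_iso hf e e' he v
  | nest B C ih =>
    intro e e' he v
    refine C.run_iso hf _ _ (fun u => ?_) v
    rw [he, ih (markNode e u) (markNode e' (f u)) (fun w => ?_) u]
    unfold markNode
    rw [he]
    refine congrArg (Fin.snoc (α := fun _ => ℝ) (e w)) ?_
    by_cases h : w = u <;> simp [h]

theorem multiHot_iso [Fintype P] (hf : IsGraphIso f) (v : G.V) :
    multiHot H (f v) = multiHot G v := by
  unfold multiHot
  rw [hf.2]

theorem atp_iso (hf : IsGraphIso f) {k : ℕ} (v : Fin k → G.V) :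
    atp H (fun i => f (v i)) = atp G v := by
  simp [atp, hf.1, hf.2]

theorem wlColor_iso (hf : IsGraphIso f) (k n : ℕ) :
    ∀ v : Fin k → G.V, wlColor H k n (fun i => f (v i)) = wlColor G k n v := by
  induction n with
  | zero => exact fun v => atp_iso hf v
  | succ n ih =>
    intro v
    refine Prod.ext (ih v) (univMultiset_iso f _ _ fun w => Prod.ext ?_ (funext fun i => ?_))
    · rw [← atp_iso hf]
      refine congrArg (atp H) (funext fun i => ?_)
      refine Fin.lastCases ?_ (fun i => ?_) i <;> simp
    · refine Eq.trans ?_ (ih _)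
      refine congrArg (wlColor H k n) (funext fun j => ?_)
      simp only [Function.update_apply]
      split <;> rfl

theorem KGNNLayer.run_iso {k D E : ℕ} (l : KGNNLayer k D E) (f : G.V ≃ H.V)
    (e : (Fin k → G.V) → Fin D → ℝ) (e' : (Fin k → H.V) → Fin D → ℝ)
    (he : ∀ v, e' (fun i => f (v i)) = e v) (v : Fin k → G.V) :
    l.run H e' (fun i => f (v i)) = l.run G e v := by
  simp only [KGNNLayer.run, he]
  congr 1
  funext j
  congr 1
  refine univMultiset_iso f _ _ fun w => ?_
  rw [← he]
  congr 1
  funext i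
  simp only [Function.update_apply]
  split <;> rfl

theorem KGNN.run_iso {k D D' : ℕ} (A : KGNN k D D') (f : G.V ≃ H.V) :
    ∀ (e : (Fin k → G.V) → Fin D → ℝ) (e' : (Fin k → H.V) → Fin D → ℝ),
      (∀ v, e' (fun i => f (v i)) = e v) →
      ∀ v, A.run H e' (fun i => f (v i)) = A.run G e v := by
  induction A with
  | single l => exact fun e e' he v => l.run_iso f e e' he v
  | cons l rest ih => exact fun e e' he v => ih _ _ (l.run_iso f e e' he) v

theorem oneHotAtp_iso [Fintype P] (hf : IsGraphIso f) (k : ℕ) (v : Fin k → G.V) :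
    oneHotAtp H k (fun i => f (v i)) = oneHotAtp G k v := by
  simp only [oneHotAtp, atp_iso hf]

end Invariance

/-! ## The classes of node classifiers -/

/-- The node classifier of an HE-GNN with input dimension `|P|` and output dimension `1`. -/
def HEGNN.cls {P : Type*} [Fintype P] {d : ℕ} (A : HEGNN d (Fintype.card P) 1) :
    NodeClassifier P where
  toFun X := open Classical in
    decide (0 < A.run X.toLabeledGraph (multiHot X.toLabeledGraph) X.pt 0)
  invariant := by
    rintro X Y ⟨f, hf, hpt⟩
    rw [← hpt, A.run_iso hf _ _ (multiHot_iso hf)]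

/-- All classifiers given by HE-GNNs of nesting depth `d`. -/
def hegnnClassifiers (P : Type*) [Fintype P] (d : ℕ) : Set (NodeClassifier P) :=
  Set.range fun A : HEGNN d (Fintype.card P) 1 => A.cls

/-- The node classifier of `k`-WL given by a number `n` of rounds and a set `S` of colours: the node
`v` is classified by the colour of the tuple `(v, …, v)`. -/
def wlCls (P : Type*) (k n : ℕ) (S : Set (WLColor P k n)) : NodeClassifier P where
  toFun X := open Classical in decide (wlColor X.toLabeledGraph k n (fun _ => X.pt) ∈ S)
  invariant := by
    rintro X Y ⟨f, hf, hpt⟩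
    rw [← hpt, ← wlColor_iso hf k n]

/-- All classifiers given by `k`-WL. -/
def wlClassifiers (P : Type*) (k : ℕ) : Set (NodeClassifier P) :=
  {c | ∃ (n : ℕ) (S : Set (WLColor P k n)), c = wlCls P k n S}

/-- The node classifier of a `k`-GNN with output dimension `1`, run on the one-hot encoding of the
atomic types: the node `v` is classified by the output at the tuple `(v, …, v)`. -/
def KGNN.cls {P : Type*} [Fintype P] {k : ℕ} (A : KGNN k (Nat.card (AtomicType P k)) 1) :
    NodeClassifier P where
  toFun X := open Classical in
    decide (0 < A.run X.toLabeledGraph (oneHotAtp X.toLabeledGraph k) (fun _ => X.pt) 0)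
  invariant := by
    rintro X Y ⟨f, hf, hpt⟩
    rw [← hpt, A.run_iso f _ _ (oneHotAtp_iso hf k)]

/-- All classifiers given by `k`-GNNs. -/
def kgnnClassifiers (P : Type*) [Fintype P] (k : ℕ) : Set (NodeClassifier P) :=
  Set.range fun A : KGNN k (Nat.card (AtomicType P k)) 1 => A.cls

end

/-!
All three families of classifiers are compared round by round, an equality of multisets indexed by
the nodes of two graphs being the same as a bijection between the nodes that matches the entries.

`(k + 1)`-GNNs with injective layers see exactly the *oblivious* refinement, in which the bijection
may depend on the position that is being replaced. It identifies two `(k + 1)`-tuples after `n`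
rounds iff their atomic types agree and `k`-WL identifies all `k`-tuples formed from their entries:
a `k`-tuple of entries of `v` misses some position `m` of `v`, so `v` can be thought of as that
`k`-tuple together with one further node, and replacing the entry at `m` is what a round of `k`-WL
does with its additional node.

An HE-GNN of nesting depth `d` is simulated by `(d + 1)`-WL by keeping the current node at one
position of the tuple and the at most `d` marked nodes at other ones. Marking the current node
copies it to a position that is still free, and moving along an edge replaces the entry at a free
position.
-/

section Tuples

theorem map_univ_eq_map_univ_iff {α β γ : Type*} [Fintype α] [Fintype β] {f : α → γ} {g : β → γ} :
    (Finset.univ : Finset α).val.map f = (Finset.univ : Finset β).val.map g ↔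
      ∃ e : α ≃ β, ∀ x, f x = g (e x) := by
  classical
  constructor
  · intro h
    have hfiber : ∀ c, Nonempty ({a // f a = c} ≃ {b // g b = c}) := fun c => by
      have hcount := congrArg (Multiset.count c) h
      rw [Multiset.count_map, Multiset.count_map] at hcount
      refine ⟨Fintype.equivOfCardEq ?_⟩
      rw [Fintype.card_subtype, Fintype.card_subtype]
      simpa [Finset.card_def, Finset.filter_val, eq_comm] using hcount
    exact ⟨Equiv.ofFiberEquiv fun c => (hfiber c).some,
      fun x => (Equiv.ofFiberEquiv_map _ x).symm⟩
  · rintro ⟨e, he⟩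
    rw [← Multiset.map_univ_val_equiv e, Multiset.map_map]
    exact Multiset.map_congr rfl fun x _ => he x

theorem exists_notMem_range_of_card_lt {α β : Type*} [Fintype α] [Fintype β]
    (hcard : Fintype.card α < Fintype.card β) (f : α → β) : ∃ b, b ∉ Set.range f :=
  not_forall.1 (mt (Fintype.card_le_of_surjective f) hcard.not_ge)

theorem exists_forall_ne_apply_ne {α : Type*} [Finite α] (h : α → α) (j : α) :
    ∃ m, ∀ l ≠ j, h l ≠ m := by
  by_contra! hall
  have hinj : Function.Injective h := Finite.injective_iff_surjective.2 fun m =>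
    (hall m).imp fun _ hl => hl.2
  obtain ⟨l, hlj, hl⟩ := hall (h j)
  exact hlj (hinj hl)

variable {A : Type*}

theorem update_comp_eq_update_comp_update {α β : Type*} [DecidableEq α] [DecidableEq β]
    {h : α → β} {j : α} {m : β} (hm : ∀ l ≠ j, h l ≠ m) (v : β → A) (x : A) :
    Function.update (v ∘ h) j x = Function.update v m x ∘ Function.update h j m := by
  rw [Function.comp_update, Function.update_self]
  funext l
  rcases eq_or_ne l j with rfl | hl
  · simp
  · simp [hl, hm l hl]

theorem update_comp_eq_update_comp_insertNth {k l : ℕ} {g : Fin l → Fin (k + 1)}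
    {j : Fin (k + 1)} {i : Fin k} (hg : j.succAbove i ∉ Set.range g) (v : Fin (k + 1) → A) (x : A) :
    Function.update v j x ∘ g =
      Function.update (v ∘ j.succAbove) i x ∘ j.insertNth (α := fun _ => Fin k) i id ∘ g := by
  funext t
  simp only [Function.comp_apply]
  obtain ht | ⟨s, ht⟩ := Fin.eq_self_or_eq_succAbove j (g t)
  · simp [ht]
  · have hsi : s ≠ i := by
      rintro rfl
      exact hg ⟨t, ht⟩
    simp [ht, hsi]

theorem snoc_comp {k l : ℕ} (v : Fin k → A) (h : Fin l → Fin k) (x : A) :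
    Fin.snoc (α := fun _ => A) (v ∘ h) x =
      Fin.snoc (α := fun _ => A) v x ∘
        Fin.snoc (α := fun _ => Fin (k + 1)) (Fin.castSucc ∘ h) (Fin.last k) := by
  rw [Fin.comp_snoc, Fin.snoc_last, ← Function.comp_assoc, Fin.snoc_comp_castSucc]

theorem snoc_comp_eq_update_comp_snoc {k l : ℕ} {g : Fin l → Fin k} {m : Fin k}
    (hm : m ∉ Set.range g) (v : Fin k → A) (x : A) :
    Fin.snoc (α := fun _ => A) (v ∘ g) x =
      Function.update v m x ∘ Fin.snoc (α := fun _ => Fin k) g m := by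
  rw [Fin.comp_snoc, Function.update_self, Function.update_comp_eq_of_notMem_range _ _ hm]

theorem update_eq_snoc_comp {k : ℕ} (j : Fin (k + 1)) (v : Fin (k + 1) → A) (x : A) :
    Function.update v j x =
      Fin.snoc (α := fun _ => A) (v ∘ j.succAbove) x ∘
        j.insertNth (α := fun _ => Fin (k + 1)) (Fin.last k) Fin.castSucc := by
  funext l
  induction l using Fin.succAboveCases j with
  | x => simp
  | p l => simp

end Tuples

section WeisfeilerLeman

variable {P : Type*} {G H : LabeledGraph P} {k : ℕ}

theorem atp_eq_iff {v : Fin k → G.V} {w : Fin k → H.V} :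
    atp G v = atp H w ↔ (∀ i j, v i = v j ↔ w i = w j) ∧
      (∀ i j, G.graph.Adj (v i) (v j) ↔ H.graph.Adj (w i) (w j)) ∧
        ∀ i, G.lab (v i) = H.lab (w i) := by
  simp only [atp, Prod.mk.injEq, funext_iff, eq_iff_iff]

theorem atp_comp {l : ℕ} {v : Fin k → G.V} {w : Fin k → H.V} (h : atp G v = atp H w)
    (g : Fin l → Fin k) : atp G (v ∘ g) = atp H (w ∘ g) := by
  obtain ⟨heq, hadj, hlab⟩ := atp_eq_iff.1 h
  exact atp_eq_iff.2 ⟨fun i j => heq _ _, fun i j => hadj _ _, fun i => hlab _⟩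

theorem wlColor_succ_eq_iff {n : ℕ} {v : Fin k → G.V} {w : Fin k → H.V} :
    wlColor G k (n + 1) v = wlColor H k (n + 1) w ↔
      wlColor G k n v = wlColor H k n w ∧ ∃ f : G.V ≃ H.V, ∀ x,
        atp G (Fin.snoc (α := fun _ => G.V) v x) = atp H (Fin.snoc (α := fun _ => H.V) w (f x)) ∧
          ∀ j, wlColor G k n (Function.update v j x) = wlColor H k n (Function.update w j (f x)) :=
  Prod.mk_inj.trans <| and_congr_right' <| map_univ_eq_map_univ_iff.trans <| by
    simp only [Prod.mk.injEq, funext_iff]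

theorem wlColor_eq_of_le {m n : ℕ} (hmn : m ≤ n) {v : Fin k → G.V} {w : Fin k → H.V}
    (h : wlColor G k n v = wlColor H k n w) : wlColor G k m v = wlColor H k m w := by
  induction hmn with
  | refl => exact h
  | step _ ih => exact ih (wlColor_succ_eq_iff.1 h).1

theorem atp_eq_of_wlColor_eq {n : ℕ} {v : Fin k → G.V} {w : Fin k → H.V}
    (h : wlColor G k n v = wlColor H k n w) : atp G v = atp H w :=
  wlColor_eq_of_le n.zero_le h

theorem wlColor_comp {n : ℕ} {v : Fin k → G.V} {w : Fin k → H.V}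
    (h : wlColor G k n v = wlColor H k n w) (g : Fin k → Fin k) :
    wlColor G k n (v ∘ g) = wlColor H k n (w ∘ g) := by
  induction n generalizing v w g with
  | zero => exact atp_comp h g
  | succ n ih =>
    obtain ⟨hvw, f, hf⟩ := wlColor_succ_eq_iff.1 h
    refine wlColor_succ_eq_iff.2 ⟨ih hvw g, f, fun x => ⟨?_, fun j => ?_⟩⟩
    · rw [snoc_comp v, snoc_comp w]
      exact atp_comp (hf x).1 _
    · obtain ⟨m, hm⟩ := exists_forall_ne_apply_ne g j
      rw [update_comp_eq_update_comp_update hm v, update_comp_eq_update_comp_update hm w]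
      exact ih ((hf x).2 m) _

theorem mem_rho_wlClassifiers {A B : PointedGraph P} :
    (A, B) ∈ rho (wlClassifiers P k) ↔ ∀ n,
      wlColor A.toLabeledGraph k n (fun _ => A.pt) =
        wlColor B.toLabeledGraph k n (fun _ => B.pt) := by
  constructor
  · intro h n
    have hcls := h _ ⟨n, {wlColor A.toLabeledGraph k n fun _ => A.pt}, rfl⟩
    simpa [wlCls, eq_comm] using hcls
  · rintro h _ ⟨n, S, rfl⟩
    simp [wlCls, h n]

end WeisfeilerLeman

section Oblivious

variable {P : Type*} {G H : LabeledGraph P} {k : ℕ}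

/-- Indistinguishability of `k`-tuples after `n` rounds of the oblivious `k`-dimensional
Weisfeiler–Leman refinement, which is the refinement that `k`-GNNs perform. Rather than by colours,
it is encoded by bijections between the nodes, one for each position and round. -/
def ObliviousWLEquiv (G H : LabeledGraph P) {k : ℕ} : ℕ → (Fin k → G.V) → (Fin k → H.V) → Prop
  | 0, v, w => atp G v = atp H w
  | n + 1, v, w => ObliviousWLEquiv G H n v w ∧ ∀ j, ∃ f : G.V ≃ H.V, ∀ x,
      ObliviousWLEquiv G H n (Function.update v j x) (Function.update w j (f x))

theorem ObliviousWLEquiv.atp_eq {n : ℕ} {v : Fin k → G.V} {w : Fin k → H.V}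
    (h : ObliviousWLEquiv G H n v w) : atp G v = atp H w := by
  induction n with
  | zero => exact h
  | succ n ih => exact ih h.1

theorem ObliviousWLEquiv.wlColor_comp_eq {n : ℕ} {v : Fin (k + 1) → G.V} {w : Fin (k + 1) → H.V}
    (h : ObliviousWLEquiv G H n v w) (g : Fin k → Fin (k + 1)) :
    wlColor G k n (v ∘ g) = wlColor H k n (w ∘ g) := by
  induction n generalizing v w g with
  | zero => exact atp_comp h g
  | succ n ih =>
    obtain ⟨m, hm⟩ := exists_notMem_range_of_card_lt (by simp) g
    obtain ⟨f, hf⟩ := h.2 m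
    refine wlColor_succ_eq_iff.2 ⟨ih h.1 g, f, fun x => ⟨?_, fun j => ?_⟩⟩
    · rw [snoc_comp_eq_update_comp_snoc hm v, snoc_comp_eq_update_comp_snoc hm w]
      exact atp_comp (hf x).atp_eq _
    · have hne : ∀ l ≠ j, g l ≠ m := fun l _ hl => hm ⟨l, hl⟩
      rw [update_comp_eq_update_comp_update hne v, update_comp_eq_update_comp_update hne w]
      exact ih (hf x) _

theorem ObliviousWLEquiv.of_wlColor_comp_eq {n : ℕ} {v : Fin (k + 1) → G.V}
    {w : Fin (k + 1) → H.V} (hatp : atp G v = atp H w)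
    (hcomp : ∀ g : Fin k → Fin (k + 1), wlColor G k n (v ∘ g) = wlColor H k n (w ∘ g)) :
    ObliviousWLEquiv G H n v w := by
  induction n generalizing v w with
  | zero => exact hatp
  | succ n ih =>
    have hcomp' : ∀ g : Fin k → Fin (k + 1), wlColor G k n (v ∘ g) = wlColor H k n (w ∘ g) :=
      fun g => wlColor_eq_of_le n.le_succ (hcomp g)
    refine ⟨ih hatp hcomp', fun j => ?_⟩
    obtain ⟨-, f, hf⟩ := wlColor_succ_eq_iff.1 (hcomp j.succAbove)
    refine ⟨f, fun x => ih ?_ fun g => ?_⟩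
    · rw [update_eq_snoc_comp j v, update_eq_snoc_comp j w]
      exact atp_comp (hf x).1 _
    · obtain ⟨m, hm⟩ := exists_notMem_range_of_card_lt (by simp) g
      obtain rfl | ⟨i, rfl⟩ := Fin.eq_self_or_eq_succAbove j m
      · rw [Function.update_comp_eq_of_notMem_range _ _ hm,
          Function.update_comp_eq_of_notMem_range _ _ hm]
        exact hcomp' g
      · rw [update_comp_eq_update_comp_insertNth hm v, update_comp_eq_update_comp_insertNth hm w]
        exact wlColor_comp ((hf x).2 i) _

theorem obliviousWLEquiv_iff {n : ℕ} {v : Fin (k + 1) → G.V} {w : Fin (k + 1) → H.V} :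
    ObliviousWLEquiv G H n v w ↔ atp G v = atp H w ∧
      ∀ g : Fin k → Fin (k + 1), wlColor G k n (v ∘ g) = wlColor H k n (w ∘ g) :=
  ⟨fun h => ⟨h.atp_eq, h.wlColor_comp_eq⟩, fun h => .of_wlColor_comp_eq h.1 h.2⟩

theorem obliviousWLEquiv_const_iff {n d : ℕ} {a : G.V} {b : H.V} :
    ObliviousWLEquiv G H n (fun _ : Fin (d + 2) => a) (fun _ => b) ↔
      wlColor G (d + 1) n (fun _ => a) = wlColor H (d + 1) n fun _ => b := by
  refine obliviousWLEquiv_iff.trans ⟨fun h => h.2 fun _ => 0, fun h => ⟨?_, fun _ => h⟩⟩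
  exact atp_comp (atp_eq_of_wlColor_eq h) fun _ : Fin (d + 2) => 0

end Oblivious

section HigherOrderGNN

variable {P : Type*} {G H : LabeledGraph P} {k D D' n : ℕ}
  {e : (Fin k → G.V) → Fin D → ℝ} {e' : (Fin k → H.V) → Fin D → ℝ}

theorem KGNNLayer.run_eq_of_obliviousWLEquiv (l : KGNNLayer k D D')
    (he : ∀ v w, ObliviousWLEquiv G H n v w → e v = e' w) {v : Fin k → G.V} {w : Fin k → H.V}
    (h : ObliviousWLEquiv G H (n + 1) v w) : l.run G e v = l.run H e' w := by
  simp only [KGNNLayer.run, he v w h.1]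
  congr 1
  funext j
  obtain ⟨f, hf⟩ := h.2 j
  exact congrArg (l.agg j) (map_univ_eq_map_univ_iff.2 ⟨f, fun x => he _ _ (hf x)⟩)

theorem KGNN.exists_run_eq_of_obliviousWLEquiv (A : KGNN k D D') :
    ∃ m, ∀ {n : ℕ} {e : (Fin k → G.V) → Fin D → ℝ} {e' : (Fin k → H.V) → Fin D → ℝ},
      (∀ v w, ObliviousWLEquiv G H n v w → e v = e' w) →
        ∀ v w, ObliviousWLEquiv G H (n + m) v w → A.run G e v = A.run H e' w := by
  induction A with
  | single l => exact ⟨1, fun he _ _ h => l.run_eq_of_obliviousWLEquiv he h⟩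
  | cons l _ ih =>
    obtain ⟨m, hm⟩ := ih
    refine ⟨1 + m, fun {n} _ _ he v w h => hm (n := n + 1) ?_ v w (by rwa [add_assoc])⟩
    exact fun _ _ h => l.run_eq_of_obliviousWLEquiv he h

theorem KGNNLayer.exists_kgnn_run_eq_run_iterate (l : KGNNLayer k D D) (last : KGNNLayer k D D')
    (n : ℕ) : ∃ A : KGNN k D D', ∀ (G : LabeledGraph P) (e : (Fin k → G.V) → Fin D → ℝ),
      A.run G e = last.run G ((l.run G)^[n] e) := by
  induction n with
  | zero => exact ⟨.single last, fun _ _ => rfl⟩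
  | succ n ih =>
    obtain ⟨A, hA⟩ := ih
    exact ⟨.cons l A, fun G e => hA G (l.run G e)⟩

theorem KGNNLayer.exists_injective (k D : ℕ) [NeZero D] :
    ∃ l : KGNNLayer k D D, (∀ j, Function.Injective (l.agg j)) ∧ Function.Injective2 l.com := by
  obtain ⟨agg⟩ := Cardinal.eq.1 (Cardinal.mk_multiset_of_infinite (Fin D → ℝ))
  obtain ⟨code⟩ := Cardinal.eq.1 (Cardinal.mk_list_eq_mk (Fin D → ℝ))
  refine ⟨⟨NeZero.pos D, fun _ => agg, fun x y => code (x :: List.ofFn y)⟩,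
    fun _ => agg.injective, fun x x' y y' h => ?_⟩
  obtain ⟨hx, hy⟩ := List.cons.inj (code.injective h)
  exact ⟨hx, List.ofFn_injective hy⟩

theorem obliviousWLEquiv_of_run_iterate_eq {l : KGNNLayer k D D}
    (hagg : ∀ j, Function.Injective (l.agg j)) (hcom : Function.Injective2 l.com)
    (he : ∀ v w, e v = e' w → atp G v = atp H w) {v : Fin k → G.V} {w : Fin k → H.V}
    (h : (l.run G)^[n] e v = (l.run H)^[n] e' w) : ObliviousWLEquiv G H n v w := by
  induction n generalizing v w with
  | zero => exact he v w h
  | succ n ih =>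
    rw [Function.iterate_succ_apply', Function.iterate_succ_apply'] at h
    obtain ⟨hself, hnbr⟩ := hcom h
    refine ⟨ih hself, fun j => ?_⟩
    obtain ⟨f, hf⟩ := map_univ_eq_map_univ_iff.1 (hagg j (congrFun hnbr j))
    exact ⟨f, fun x => ih (hf x)⟩

theorem oneHotAtp_eq_iff [Fintype P] {v : Fin k → G.V} {w : Fin k → H.V} :
    oneHotAtp G k v = oneHotAtp H k w ↔ atp G v = atp H w := by
  refine ⟨fun h => ?_, fun h => by simp only [oneHotAtp, h]⟩
  by_contra hne
  have hcoord := congrFun h (Finite.equivFin _ (atp G v))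
  simp [oneHotAtp, hne] at hcoord

theorem run_iterate_eq_of_mem_rho_kgnnClassifiers [Fintype P] {A B : PointedGraph P}
    (h : (A, B) ∈ rho (kgnnClassifiers P k))
    (l : KGNNLayer k (Nat.card (AtomicType P k)) (Nat.card (AtomicType P k))) (n : ℕ) :
    (l.run A.toLabeledGraph)^[n] (oneHotAtp A.toLabeledGraph k) (fun _ => A.pt) =
      (l.run B.toLabeledGraph)^[n] (oneHotAtp B.toLabeledGraph k) fun _ => B.pt := by
  classical
  set c := (l.run A.toLabeledGraph)^[n] (oneHotAtp A.toLabeledGraph k) fun _ => A.pt with hc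
  let indicator : KGNNLayer k (Nat.card (AtomicType P k)) 1 :=
    ⟨one_pos, fun _ _ => 0, fun x _ _ => if x = c then 1 else 0⟩
  obtain ⟨C, hC⟩ := l.exists_kgnn_run_eq_run_iterate (P := P) indicator n
  have hcls := h _ ⟨C, rfl⟩
  simp only [KGNN.cls, hC, indicator, KGNNLayer.run, ← hc] at hcls
  by_contra hne
  simp [Ne.symm hne] at hcls

theorem mem_rho_kgnnClassifiers [Fintype P] {A B : PointedGraph P} :
    (A, B) ∈ rho (kgnnClassifiers P k) ↔ ∀ n,
      ObliviousWLEquiv A.toLabeledGraph B.toLabeledGraph n (fun _ : Fin k => A.pt)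
        fun _ => B.pt := by
  constructor
  · intro h n
    have : NeZero (Nat.card (AtomicType P k)) := ⟨Nat.card_pos.ne'⟩
    obtain ⟨l, hagg, hcom⟩ := KGNNLayer.exists_injective k (Nat.card (AtomicType P k))
    exact obliviousWLEquiv_of_run_iterate_eq hagg hcom (fun _ _ => oneHotAtp_eq_iff.1)
      (run_iterate_eq_of_mem_rho_kgnnClassifiers h l n)
  · rintro h _ ⟨C, rfl⟩
    obtain ⟨m, hm⟩ := C.exists_run_eq_of_obliviousWLEquiv
      (G := A.toLabeledGraph) (H := B.toLabeledGraph)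
    simp only [KGNN.cls, hm (n := 0) (fun _ _ => oneHotAtp_eq_iff.2) _ _ (h (0 + m))]

end HigherOrderGNN

section HierarchicalEgoGNN

variable {P : Type*} {G H : LabeledGraph P} {k : ℕ}

theorem nbrMultiset_eq_of_equiv {Y : Type*} {e : G.V → Y} {e' : H.V → Y} {u : G.V} {u' : H.V}
    (f : G.V ≃ H.V) (hadj : ∀ x, G.graph.Adj u x ↔ H.graph.Adj u' (f x))
    (he : ∀ x, e x = e' (f x)) : nbrMultiset G e u = nbrMultiset H e' u' := by
  classical
  simp only [nbrMultiset, Finset.filter_val, ← Multiset.map_univ_val_equiv f, Multiset.filter_map,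
    Multiset.map_map, Function.comp_def, he]
  exact congrArg _ (Multiset.filter_congr fun x _ => hadj x)

/-- A family of node embeddings, parametrized by the `k`-tuples of nodes of each graph, is
WL-invariant after `n` rounds with free positions `X` if `F G v` does not depend on the entries of
`v` at positions in `X`, and if its value at the node in a position of `X` is determined by the
colour of `v` after `n` rounds of `k`-WL. It describes the embeddings that an HE-GNN computes: the
positions outside `X` hold the marked nodes, those in `X` the node where the embedding is
evaluated. -/
structure IsWLInvariant {Y : Type*} (n : ℕ) (X : Finset (Fin k))
    (F : (G : LabeledGraph P) → (Fin k → G.V) → G.V → Y) : Prop where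
  update_eq : ∀ (G : LabeledGraph P) (v : Fin k → G.V), ∀ i ∈ X, ∀ x,
    F G (Function.update v i x) = F G v
  apply_eq : ∀ {G H : LabeledGraph P} {v : Fin k → G.V} {w : Fin k → H.V},
    wlColor G k n v = wlColor H k n w → ∀ i ∈ X, F G v (v i) = F H w (w i)

namespace IsWLInvariant

variable {n D D' : ℕ} {X : Finset (Fin k)}
  {F : (G : LabeledGraph P) → (Fin k → G.V) → G.V → Fin D → ℝ}

theorem gnnLayer_run (hF : IsWLInvariant n X F) (l : GNNLayer D D') :
    IsWLInvariant (n + 1) X fun G v => l.run G (F G v) where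
  update_eq G v i hi x := by rw [hF.update_eq G v i hi]
  apply_eq {G H v w} h i hi := by
    obtain ⟨hvw, f, hf⟩ := wlColor_succ_eq_iff.1 h
    have hadj : ∀ x, G.graph.Adj (v i) x ↔ H.graph.Adj (w i) (f x) := fun x => by
      simpa using (atp_eq_iff.1 (hf x).1).2.1 i.castSucc (Fin.last k)
    have hemb : ∀ x, F G v x = F H w (f x) := fun x => by
      simpa [hF.update_eq _ _ i hi] using hF.apply_eq ((hf x).2 i) i hi
    simp only [GNNLayer.run, hF.apply_eq hvw i hi, nbrMultiset_eq_of_equiv f hadj hemb]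

theorem exists_gnn_run (A : GNN D D') :
    ∃ m, ∀ {n : ℕ} {X : Finset (Fin k)}
      {F : (G : LabeledGraph P) → (Fin k → G.V) → G.V → Fin D → ℝ},
      IsWLInvariant n X F → IsWLInvariant (n + m) X fun G v => A.run G (F G v) := by
  induction A with
  | single l => exact ⟨1, fun hF => hF.gnnLayer_run l⟩
  | cons l _ ih =>
    obtain ⟨m, hm⟩ := ih
    exact ⟨1 + m, fun hF => add_assoc _ 1 m ▸ hm (hF.gnnLayer_run l)⟩

theorem erase_markNode (hF : IsWLInvariant n X F) (i : Fin k) :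
    IsWLInvariant n (X.erase i) fun G v => markNode (F G v) (v i) where
  update_eq G v j hj x := by
    obtain ⟨hji, hjX⟩ := Finset.mem_erase.1 hj
    rw [hF.update_eq G v j hjX, Function.update_of_ne hji.symm]
  apply_eq {G H v w} h j hj := by
    have hmark : v j = v i ↔ w j = w i := (atp_eq_iff.1 (atp_eq_of_wlColor_eq h)).1 j i
    simp only [markNode, hF.apply_eq h j (Finset.mem_of_mem_erase hj)]
    classical exact congrArg _ (if_congr hmark rfl rfl)

theorem append_markNode_run {d m : ℕ} {B : HEGNN d (D + 1) D'} (hF : IsWLInvariant n X F)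
    (hX : 1 < X.card)
    (hB : ∀ i ∈ X, IsWLInvariant (n + m) (X.erase i)
      fun G v => B.run G (markNode (F G v) (v i))) :
    IsWLInvariant (n + m) X
      fun G v u => Fin.append (F G v u) (B.run G (markNode (F G v) u) u) where
  update_eq G v i hi x := by rw [hF.update_eq G v i hi]
  apply_eq {G H v w} h i hi := by
    obtain ⟨j, hj, hji⟩ := Finset.exists_mem_ne hX i
    -- The node `v i` at which `B` is evaluated is also the marked one, so the tuple has to hold it
    -- at two positions.
    have hcopy : wlColor G k (n + m) (Function.update v j (v i)) =
        wlColor H k (n + m) (Function.update w j (w i)) := by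
      simpa only [Function.comp_update, Function.comp_id] using
        wlColor_comp h (Function.update id j i)
    have hrun := (hB i hi).apply_eq hcopy j (Finset.mem_erase.2 ⟨hji, hj⟩)
    simp only [hF.update_eq _ _ j hj, Function.update_self, Function.update_of_ne hji.symm] at hrun
    rw [hrun, hF.apply_eq (wlColor_eq_of_le (Nat.le_add_right n m) h) i hi]

theorem exists_hegnn_run {d : ℕ} (A : HEGNN d D D') :
    ∃ m, ∀ {n : ℕ} {X : Finset (Fin k)}
      {F : (G : LabeledGraph P) → (Fin k → G.V) → G.V → Fin D → ℝ},
      d < X.card → IsWLInvariant n X F → IsWLInvariant (n + m) X fun G v => A.run G (F G v) := by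
  induction A with
  | base A =>
    obtain ⟨m, hm⟩ := exists_gnn_run (P := P) (k := k) A
    exact ⟨m, fun _ => hm⟩
  | nest B C ih =>
    obtain ⟨p, hp⟩ := ih
    obtain ⟨q, hq⟩ := exists_gnn_run (P := P) (k := k) C
    refine ⟨p + q, fun {n X F} hX hF => add_assoc n p q ▸ hq ?_⟩
    refine hF.append_markNode_run (by lia) fun i hi => hp ?_ (hF.erase_markNode i)
    rw [Finset.card_erase_of_mem hi]
    lia

end IsWLInvariant

theorem isWLInvariant_multiHot [Fintype P] (X : Finset (Fin k)) :
    IsWLInvariant 0 X fun (G : LabeledGraph P) _ => multiHot G where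
  update_eq _ _ _ _ _ := rfl
  apply_eq {G H v w} h i _ := by
    unfold multiHot
    rw [(atp_eq_iff.1 h).2.2 i]

theorem rho_wlClassifiers_subset_rho_hegnnClassifiers (P : Type*) [Fintype P] (d : ℕ) :
    rho (wlClassifiers P (d + 1)) ⊆ rho (hegnnClassifiers P d) := by
  rintro ⟨A, B⟩ hAB _ ⟨C, rfl⟩
  obtain ⟨m, hm⟩ := IsWLInvariant.exists_hegnn_run (P := P) (k := d + 1) C
  have hrun := (hm (by simp) (isWLInvariant_multiHot Finset.univ)).apply_eq
    (mem_rho_wlClassifiers.1 hAB (0 + m)) 0 (Finset.mem_univ _)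
  simp only [HEGNN.cls, hrun]

end HierarchicalEgoGNN

theorem rho_wlClassifiers_eq_rho_kgnnClassifiers (P : Type*) [Fintype P] (d : ℕ) :
    rho (wlClassifiers P (d + 1)) = rho (kgnnClassifiers P (d + 2)) := by
  ext ⟨A, B⟩
  simp only [mem_rho_wlClassifiers, mem_rho_kgnnClassifiers, obliviousWLEquiv_const_iff]

theorem mainTheorem5 {P : Type*} [Fintype P] (d : ℕ) :
    rho (wlClassifiers P (d + 1)) = rho (kgnnClassifiers P (d + 2)) ∧
      rho (kgnnClassifiers P (d + 2)) ⊆ rho (hegnnClassifiers P d) := by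
  have heq := rho_wlClassifiers_eq_rho_kgnnClassifiers P d
  exact ⟨heq, heq ▸ rho_wlClassifiers_subset_rho_hegnnClassifiers P d⟩
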